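/- Let $\mathcal K$ be a tensor triangulated category: a triangulated category with a symmetric monoidal structure $(\otimes,\mathbb 1)$ such that $X\otimes-$ and $-\otimes X$ are exact functors for every object $X$, the natural suspension isomorphisms $\Sigma X\otimes Y\simeq\Sigma(X\otimes Y)\simeq X\otimes\Sigma Y$ are compatible with the symmetry, associator and unitors, and the two isomorphisms $\Sigma X\otimes\Sigma Y\simeq\Sigma^2(X\otimes Y)$ differ by the sign $-1$. No rigidity or idempotent-completeness is assumed. Let $\Phi$ be a non-empty set of objects of $\mathcal K$ such that $a,b\in\Phi$ implies $a\otimes b\in\Phi$. Let $\operatorname{Spc}(\mathcal K)$ be the set of prime ideals of $\mathcal K$, i.e. of proper thick triangulated $\otimes$-ideals $\mathcal P$ such that $a\otimes b\in\mathcal P$ implies $a\in\mathcal P$ or $b\in\mathcal P$. Put $\operatorname{supp}(a)=\{\mathcal P : a\notin\mathcal P\}$, and give $\operatorname{Spc}(\mathcal K)$ the topology whose closed sets are the intersections of supports of objects. Let $\mathcal Z_\Phi=\bigcap_{X\in\Phi}\operatorname{supp}(X)$, with the subspace topology. For an object $X$ let $E_X=\{f\in\operatorname{End}(X) : f\otimes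 X=X\otimes f \text{ on } X\otimes X\}$, and let $R_\Phi$ be the quotient of $\{(X,f) : X\in\Phi,\ f\in E_X\}$ by the smallest equivalence relation with $(X,f)\sim(a\otimes X,a\otimes f)$ and $(X,f)\sim(X\otimes a,f\otimes a)$ for all $a\in\Phi$. It is a commutative ring under $[f_X]+[g_Y]=[f\otimes Y+X\otimes g]$ and $[f_X]\cdot[g_Y]=[(f\otimes Y)\circ(X\otimes g)]$, where $f_X$ indicates that $f\in E_X$. If $\mathcal Z_\Phi$ is connected, then $\operatorname{Spec}(R_\Phi)$ is connected (and this holds both when the empty space is counted as connected and when it is not). -/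

import Mathlib

open CategoryTheory MonoidalCategory Limits ZeroObject

/-- A tensor triangulated category: a triangulated category with a symmetric monoidal structure,
together with isomorphisms `X ⊗ Y⟦n⟧ ≅ (X ⊗ Y)⟦n⟧` and `X⟦n⟧ ⊗ Y ≅ (X ⊗ Y)⟦n⟧` natural in both
variables and compatible with the shift structure, such that the two ways from `X⟦m⟧ ⊗ Y⟦n⟧` to
`(X ⊗ Y)⟦m + n⟧` differ by `(-1) ^ (m * n)` (so that the square for `m = n = 1` anticommutes; all
this is the content of `Functor.CommShift₂Int`), such that `X ⊗ -` and `- ⊗ X` are exact functors,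
and such that the suspension isomorphisms are compatible with the symmetry, the associator and the
unitors (the compatibilities not listed follow from those listed through the symmetry). -/
class TensorTriangulatedCategory (K : Type*) [Category* K] [Preadditive K] [HasZeroObject K]
    [HasShift K ℤ] [∀ n : ℤ, (shiftFunctor K n).Additive] [Pretriangulated K]
    [MonoidalCategory K] [SymmetricCategory K] extends
    Functor.CommShift₂Int (curriedTensor K) where
  exact_tensorLeft (X : K) : (tensorLeft X).IsTriangulated
  exact_tensorRight (X : K) : (tensorRight X).IsTriangulated
  braiding_shift (X Y : K) :
    (β_ (X⟦(1 : ℤ)⟧) Y).hom ≫ ((tensorLeft Y).commShiftIso (1 : ℤ)).hom.app X =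
      ((tensorRight Y).commShiftIso (1 : ℤ)).hom.app X ≫ ((β_ X Y).hom)⟦(1 : ℤ)⟧'
  associator_shift (X Y Z : K) :
    (α_ (X⟦(1 : ℤ)⟧) Y Z).hom ≫ ((tensorRight (Y ⊗ Z)).commShiftIso (1 : ℤ)).hom.app X =
      (((tensorRight Y).commShiftIso (1 : ℤ)).hom.app X) ▷ Z ≫
        ((tensorRight Z).commShiftIso (1 : ℤ)).hom.app (X ⊗ Y) ≫ ((α_ X Y Z).hom)⟦(1 : ℤ)⟧'
  rightUnitor_shift (X : K) :
    (ρ_ (X⟦(1 : ℤ)⟧)).hom =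
      ((tensorRight (𝟙_ K)).commShiftIso (1 : ℤ)).hom.app X ≫ ((ρ_ X).hom)⟦(1 : ℤ)⟧'

namespace TensorTriangulatedCategory

section Triangular

variable {K : Type*} [Category* K] [Preadditive K] [HasZeroObject K]
  [HasShift K ℤ] [∀ n : ℤ, (shiftFunctor K n).Additive] [Pretriangulated K]
  [MonoidalCategory K]

/-- Exact functors are additive, so the tensor product is additive in both variables. -/
instance monoidalPreadditive [SymmetricCategory K] [TensorTriangulatedCategory K] : MonoidalPreadditive K where
  whiskerLeft_zero {X Y Z} := by
    have := exact_tensorLeft X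
    exact (tensorLeft X).map_zero Y Z
  zero_whiskerRight {X Y Z} := by
    have := exact_tensorRight X
    exact (tensorRight X).map_zero Y Z
  whiskerLeft_add {X Y Z} f g := by
    have := exact_tensorLeft X
    exact (tensorLeft X).map_add
  add_whiskerRight {X Y Z} f g := by
    have := exact_tensorRight X
    exact (tensorRight X).map_add

variable (K) in
/-- The triangular spectrum of `K`: the set of prime ideals of `K`, i.e. of proper thick
triangulated `⊗`-ideals `P` such that `a ⊗ b ∈ P` implies `a ∈ P` or `b ∈ P`. -/
@[ext]
structure Spc where
  /-- The class of objects of the prime. -/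
  carrier : ObjectProperty K
  isTriangulated : carrier.IsTriangulated
  thick : carrier.IsStableUnderRetracts
  tensor_mem (a b : K) : carrier b → carrier (a ⊗ b)
  proper : ∃ a : K, ¬ carrier a
  prime (a b : K) : carrier (a ⊗ b) → carrier a ∨ carrier b

lemma Spc.biprod_mem_iff (P : Spc K) (a b : K) :
    P.carrier (a ⊞ b) ↔ P.carrier a ∧ P.carrier b := by
  have := P.isTriangulated
  have := P.thick
  refine ⟨fun h => ⟨ObjectProperty.IsStableUnderRetracts.of_biprod_left _ h,
    ObjectProperty.IsStableUnderRetracts.of_biprod_right _ h⟩, fun h => ?_⟩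
  exact P.carrier.ext_of_isTriangulatedClosed₂ _
    (Pretriangulated.binaryBiproductTriangle_distinguished a b) h.1 h.2

/-- The support of an object: the primes not containing it. -/
def supp (a : K) : Set (Spc K) := {P | ¬ P.carrier a}

/-- The Balmer topology: the closed sets are the sets `{P | S ∩ P = ∅}`, for `S` a collection of
objects of `K`; that is, the intersections of supports of objects. -/
instance : TopologicalSpace (Spc K) where
  IsOpen U := ∃ S : Set K, Uᶜ = ⋂ a ∈ S, supp a
  isOpen_univ := ⟨{0}, by
    ext P
    have := P.isTriangulated
    have := P.thick
    simpa [supp] using P.carrier.prop_zero⟩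
  isOpen_inter := by
    rintro U V ⟨S, hS⟩ ⟨T, hT⟩
    refine ⟨{c | ∃ a ∈ S, ∃ b ∈ T, c = (a ⊞ b : K)}, ?_⟩
    rw [Set.compl_inter, hS, hT]
    ext P
    simp only [supp, Set.mem_union, Set.mem_iInter, Set.mem_ofPred_eq]
    constructor
    · rintro h c ⟨a, ha, b, hb, rfl⟩ hc
      rw [Spc.biprod_mem_iff] at hc
      rcases h with h | h
      exacts [h a ha hc.1, h b hb hc.2]
    · intro h
      by_contra! hc
      obtain ⟨⟨a, ha, ha'⟩, ⟨b, hb, hb'⟩⟩ := hc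
      exact h _ ⟨a, ha, b, hb, rfl⟩ ((P.biprod_mem_iff a b).2 ⟨ha', hb'⟩)
  isOpen_sUnion := by
    intro s hs
    choose! S hS using hs
    refine ⟨⋃ U ∈ s, S U, ?_⟩
    ext P
    simp only [Set.mem_compl_iff, Set.mem_sUnion, not_exists, not_and, Set.mem_iInter,
      Set.mem_iUnion, exists_prop]
    constructor
    · rintro h a ⟨U, hU, ha⟩
      have : P ∈ Uᶜ := h U hU
      rw [hS U hU] at this
      exact Set.mem_iInter₂.1 this a ha
    · intro h U hU
      change P ∈ Uᶜ
      rw [hS U hU]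
      exact Set.mem_iInter₂.2 fun a ha => h a ⟨U, hU, ha⟩

end Triangular

/-- A non-empty collection of objects closed under the tensor product. -/
structure MultiplicativeSet (K : Type*) [Category* K] [MonoidalCategory K] where
  /-- The underlying collection of objects. -/
  carrier : Set K
  nonempty : carrier.Nonempty
  tensor_mem {a b : K} : a ∈ carrier → b ∈ carrier → a ⊗ b ∈ carrier

/-- The closed subset `⋂_{X ∈ Φ} supp X` of the spectrum. -/
def MultiplicativeSet.zeroLocus {K : Type*} [Category* K] [Preadditive K] [HasZeroObject K]
    [HasShift K ℤ] [∀ n : ℤ, (shiftFunctor K n).Additive] [Pretriangulated K]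
    [MonoidalCategory K] (Φ : MultiplicativeSet K) : Set (Spc K) :=
  ⋂ X ∈ Φ.carrier, supp X

section Balanced

variable {K : Type*} [Category* K] [Preadditive K] [MonoidalCategory K] [MonoidalPreadditive K]

/-- The ring `E_X` of `⊗`-balanced endomorphisms of `X`: those `f` with `f ⊗ X = X ⊗ f`. -/
def balancedEnd (X : K) : Subring (End X) where
  carrier := {f | f ▷ X = X ◁ f}
  mul_mem' {f g} hf hg := by
    simp only [Set.mem_ofPred_eq] at hf hg ⊢
    rw [End.mul_def, comp_whiskerRight, whiskerLeft_comp, hf, hg]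
  one_mem' := by simp [End.one_def]
  add_mem' {f g} hf hg := by
    simp only [Set.mem_ofPred_eq] at hf hg ⊢
    rw [MonoidalPreadditive.add_whiskerRight, MonoidalPreadditive.whiskerLeft_add, hf, hg]
  zero_mem' := by simp
  neg_mem' {f} hf := by
    simp only [Set.mem_ofPred_eq] at hf ⊢
    exact ((tensorRight X).map_neg (f := f)).trans
      ((congrArg Neg.neg hf).trans ((tensorLeft X).map_neg (f := f)).symm)

lemma mem_balancedEnd {X : K} {f : End X} : f ∈ balancedEnd X ↔ f ▷ X = X ◁ f := Iff.rfl

variable [SymmetricCategory K]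

lemma tensor_mem_balancedEnd {X Y : K} {f : End X} {g : End Y}
    (hf : f ∈ balancedEnd X) (hg : g ∈ balancedEnd Y) :
    (f ⊗ₘ g : End (X ⊗ Y)) ∈ balancedEnd (X ⊗ Y) := by
  rw [mem_balancedEnd] at *
  have h := tensorμ_natural_left f g X Y
  have h' := tensorμ_natural_right X Y f g
  rw [hf, hg, ← h'] at h
  have : IsIso (tensorμ X Y X Y) :=
    ⟨tensorδ X Y X Y, tensorμ_tensorδ X Y X Y, tensorδ_tensorμ X Y X Y⟩
  exact (cancel_mono _).1 h

/-- `f ⊗ Y` for a balanced endomorphism `f` of `X`, as a balanced endomorphism of `X ⊗ Y`. -/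
def tensorObj {X : K} (f : balancedEnd X) (Y : K) : balancedEnd (X ⊗ Y) :=
  ⟨(f : End X) ▷ Y, by
    have := tensor_mem_balancedEnd f.2 (one_mem (balancedEnd Y))
    rwa [End.one_def, tensorHom_id] at this⟩

/-- `X ⊗ g` for a balanced endomorphism `g` of `Y`, as a balanced endomorphism of `X ⊗ Y`. -/
def objTensor (X : K) {Y : K} (g : balancedEnd Y) : balancedEnd (X ⊗ Y) :=
  ⟨X ◁ (g : End Y), by
    have := tensor_mem_balancedEnd (one_mem (balancedEnd X)) g.2
    rwa [End.one_def, id_tensorHom] at this⟩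

end Balanced

section Ring

variable {K : Type*} [Category* K] [Preadditive K] [MonoidalCategory K] [MonoidalPreadditive K]
  [SymmetricCategory K]

/-- The elementary identifications `(X, f) ∼ (a ⊗ X, a ⊗ f)` and `(X, f) ∼ (X ⊗ a, f ⊗ a)`, for
`a ∈ Φ`, on the pairs `(X, f)` with `X ∈ Φ` and `f` a balanced endomorphism of `X`. -/
inductive EndStep (Φ : MultiplicativeSet K) :
    (Σ X : Φ.carrier, balancedEnd (X : K)) → (Σ X : Φ.carrier, balancedEnd (X : K)) → Prop
  | left (a X : Φ.carrier) (f : balancedEnd (X : K)) :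
      EndStep Φ ⟨X, f⟩ ⟨⟨(a : K) ⊗ (X : K), Φ.tensor_mem a.2 X.2⟩, objTensor (a : K) f⟩
  | right (a X : Φ.carrier) (f : balancedEnd (X : K)) :
      EndStep Φ ⟨X, f⟩ ⟨⟨(X : K) ⊗ (a : K), Φ.tensor_mem X.2 a.2⟩, tensorObj f (a : K)⟩

/-- The ring `R_Φ`: the quotient of `{(X, f) | X ∈ Φ, f ∈ E_X}` by the smallest equivalence
relation containing the elementary identifications. -/
def EndRing (Φ : MultiplicativeSet K) : Type _ := Quot (EndStep Φ)

namespace EndRing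

variable {Φ : MultiplicativeSet K}

/-- The class `[f_X]`. -/
def mk {X : K} (hX : X ∈ Φ.carrier) (f : balancedEnd X) : EndRing Φ :=
  Quot.mk _ ⟨⟨X, hX⟩, f⟩

lemma mk_objTensor {a X : K} (ha : a ∈ Φ.carrier) (hX : X ∈ Φ.carrier) (f : balancedEnd X) :
    mk (Φ.tensor_mem ha hX) (objTensor a f) = mk hX f :=
  (Quot.sound (EndStep.left ⟨a, ha⟩ ⟨X, hX⟩ f)).symm

lemma mk_tensorObj {a X : K} (ha : a ∈ Φ.carrier) (hX : X ∈ Φ.carrier) (f : balancedEnd X) :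
    mk (Φ.tensor_mem hX ha) (tensorObj f a) = mk hX f :=
  (Quot.sound (EndStep.right ⟨a, ha⟩ ⟨X, hX⟩ f)).symm

/-- Endomorphisms that correspond under an isomorphism `X ≅ Y` have the same class. -/
lemma mk_eq_of_iso {X Y : K} (hX : X ∈ Φ.carrier) (hY : Y ∈ Φ.carrier)
    (f : balancedEnd X) (g : balancedEnd Y) (e : X ≅ Y)
    (h : (f : End X) ≫ e.hom = e.hom ≫ (g : End Y)) : mk hX f = mk hY g := by
  rw [← mk_tensorObj hY hX f, ← mk_objTensor hX hY g]
  congr 1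
  apply Subtype.ext
  change (f : End X) ▷ Y = X ◁ (g : End Y)
  have hf : (f : End X) ▷ X = X ◁ (f : End X) := f.2
  have hg : (g : End Y) = e.inv ≫ (f : End X) ≫ e.hom := by rw [h, Iso.inv_hom_id_assoc]
  rw [hg, whiskerLeft_comp, whiskerLeft_comp, ← hf, ← whisker_exchange,
    whiskerLeft_inv_hom_assoc]

/-- The balanced endomorphism `f ⊗ Y + X ⊗ g` of `X ⊗ Y`. -/
def addAux {X Y : K} (f : balancedEnd X) (g : balancedEnd Y) : balancedEnd (X ⊗ Y) :=
  tensorObj f Y + objTensor X g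

/-- The balanced endomorphism `(f ⊗ Y) ∘ (X ⊗ g)` of `X ⊗ Y`. -/
def mulAux {X Y : K} (f : balancedEnd X) (g : balancedEnd Y) : balancedEnd (X ⊗ Y) :=
  tensorObj f Y * objTensor X g

lemma coe_addAux {X Y : K} (f : balancedEnd X) (g : balancedEnd Y) :
    (addAux f g : End (X ⊗ Y)) = ((f : End X) ▷ Y + X ◁ (g : End Y) : X ⊗ Y ⟶ X ⊗ Y) := rfl

lemma coe_mulAux {X Y : K} (f : balancedEnd X) (g : balancedEnd Y) :
    (mulAux f g : End (X ⊗ Y)) = (X ◁ (g : End Y) ≫ (f : End X) ▷ Y : X ⊗ Y ⟶ X ⊗ Y) := rfl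

lemma coe_tensorObj {X : K} (f : balancedEnd X) (Y : K) :
    (tensorObj f Y : End (X ⊗ Y)) = ((f : End X) ▷ Y : X ⊗ Y ⟶ X ⊗ Y) := rfl

lemma coe_objTensor (X : K) {Y : K} (g : balancedEnd Y) :
    (objTensor X g : End (X ⊗ Y)) = (X ◁ (g : End Y) : X ⊗ Y ⟶ X ⊗ Y) := rfl

lemma mk_addAux_comm {X Y : K} (hX : X ∈ Φ.carrier) (hY : Y ∈ Φ.carrier)
    (f : balancedEnd X) (g : balancedEnd Y) :
    mk (Φ.tensor_mem hX hY) (addAux f g) = mk (Φ.tensor_mem hY hX) (addAux g f) := by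
  refine mk_eq_of_iso _ _ _ _ (β_ X Y) ?_
  rw [coe_addAux, coe_addAux, Preadditive.add_comp, Preadditive.comp_add,
    BraidedCategory.braiding_naturality_left, BraidedCategory.braiding_naturality_right, add_comm]

lemma mk_mulAux_comm {X Y : K} (hX : X ∈ Φ.carrier) (hY : Y ∈ Φ.carrier)
    (f : balancedEnd X) (g : balancedEnd Y) :
    mk (Φ.tensor_mem hX hY) (mulAux f g) = mk (Φ.tensor_mem hY hX) (mulAux g f) := by
  refine mk_eq_of_iso _ _ _ _ (β_ X Y) ?_
  rw [coe_mulAux, coe_mulAux, Category.assoc, BraidedCategory.braiding_naturality_left,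
    BraidedCategory.braiding_naturality_right_assoc, whisker_exchange]

lemma mk_addAux_objTensor {a X Y : K} (ha : a ∈ Φ.carrier) (hX : X ∈ Φ.carrier)
    (hY : Y ∈ Φ.carrier) (f : balancedEnd X) (g : balancedEnd Y) :
    mk (Φ.tensor_mem (Φ.tensor_mem ha hX) hY) (addAux (objTensor a f) g) =
      mk (Φ.tensor_mem hX hY) (addAux f g) := by
  rw [← mk_objTensor ha (Φ.tensor_mem hX hY) (addAux f g)]
  refine mk_eq_of_iso _ _ _ _ (α_ a X Y) ?_
  simp [coe_addAux, coe_objTensor]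

lemma mk_mulAux_objTensor {a X Y : K} (ha : a ∈ Φ.carrier) (hX : X ∈ Φ.carrier)
    (hY : Y ∈ Φ.carrier) (f : balancedEnd X) (g : balancedEnd Y) :
    mk (Φ.tensor_mem (Φ.tensor_mem ha hX) hY) (mulAux (objTensor a f) g) =
      mk (Φ.tensor_mem hX hY) (mulAux f g) := by
  rw [← mk_objTensor ha (Φ.tensor_mem hX hY) (mulAux f g)]
  refine mk_eq_of_iso _ _ _ _ (α_ a X Y) ?_
  simp [coe_mulAux, coe_objTensor]

lemma mk_addAux_tensorObj {a X Y : K} (ha : a ∈ Φ.carrier) (hX : X ∈ Φ.carrier)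
    (hY : Y ∈ Φ.carrier) (f : balancedEnd X) (g : balancedEnd Y) :
    mk (Φ.tensor_mem (Φ.tensor_mem hX ha) hY) (addAux (tensorObj f a) g) =
      mk (Φ.tensor_mem hX hY) (addAux f g) := by
  rw [← mk_addAux_objTensor ha hX hY]
  refine mk_eq_of_iso _ _ _ _ (whiskerRightIso (β_ X a) Y) ?_
  simp only [coe_addAux, coe_objTensor, coe_tensorObj, whiskerRightIso_hom,
    Preadditive.add_comp, Preadditive.comp_add, ← comp_whiskerRight,
    BraidedCategory.braiding_naturality_left, whisker_exchange]

lemma mk_mulAux_tensorObj {a X Y : K} (ha : a ∈ Φ.carrier) (hX : X ∈ Φ.carrier)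
    (hY : Y ∈ Φ.carrier) (f : balancedEnd X) (g : balancedEnd Y) :
    mk (Φ.tensor_mem (Φ.tensor_mem hX ha) hY) (mulAux (tensorObj f a) g) =
      mk (Φ.tensor_mem hX hY) (mulAux f g) := by
  rw [← mk_mulAux_objTensor ha hX hY]
  refine mk_eq_of_iso _ _ _ _ (whiskerRightIso (β_ X a) Y) ?_
  simp only [coe_mulAux, coe_objTensor, coe_tensorObj, whiskerRightIso_hom, Category.assoc,
    ← comp_whiskerRight, BraidedCategory.braiding_naturality_left]
  simp only [comp_whiskerRight, whisker_exchange_assoc]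

/-- The sum is `[f_X] + [g_Y] = [f ⊗ Y + X ⊗ g]`. -/
instance : Add (EndRing Φ) where
  add x y := Quot.liftOn₂ x y (fun p q => mk (Φ.tensor_mem p.1.2 q.1.2) (addAux p.2 q.2))
    (by
      rintro ⟨⟨X, hX⟩, f⟩ _ _ (⟨⟨a, ha⟩, ⟨Y, hY⟩, g⟩ | ⟨⟨a, ha⟩, ⟨Y, hY⟩, g⟩)
      · dsimp only
        rw [mk_addAux_comm hX hY, mk_addAux_comm hX (Φ.tensor_mem ha hY), mk_addAux_objTensor ha hY hX]
      · dsimp only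
        rw [mk_addAux_comm hX hY, mk_addAux_comm hX (Φ.tensor_mem hY ha), mk_addAux_tensorObj ha hY hX])
    (by
      rintro _ _ ⟨⟨Y, hY⟩, g⟩ (⟨⟨a, ha⟩, ⟨X, hX⟩, f⟩ | ⟨⟨a, ha⟩, ⟨X, hX⟩, f⟩)
      exacts [(mk_addAux_objTensor ha hX hY f g).symm, (mk_addAux_tensorObj ha hX hY f g).symm])

/-- The product is `[f_X] * [g_Y] = [(f ⊗ Y) ∘ (X ⊗ g)]`. -/
instance : Mul (EndRing Φ) where
  mul x y := Quot.liftOn₂ x y (fun p q => mk (Φ.tensor_mem p.1.2 q.1.2) (mulAux p.2 q.2))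
    (by
      rintro ⟨⟨X, hX⟩, f⟩ _ _ (⟨⟨a, ha⟩, ⟨Y, hY⟩, g⟩ | ⟨⟨a, ha⟩, ⟨Y, hY⟩, g⟩)
      · dsimp only
        rw [mk_mulAux_comm hX hY, mk_mulAux_comm hX (Φ.tensor_mem ha hY), mk_mulAux_objTensor ha hY hX]
      · dsimp only
        rw [mk_mulAux_comm hX hY, mk_mulAux_comm hX (Φ.tensor_mem hY ha), mk_mulAux_tensorObj ha hY hX])
    (by
      rintro _ _ ⟨⟨Y, hY⟩, g⟩ (⟨⟨a, ha⟩, ⟨X, hX⟩, f⟩ | ⟨⟨a, ha⟩, ⟨X, hX⟩, f⟩)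
      exacts [(mk_mulAux_objTensor ha hX hY f g).symm, (mk_mulAux_tensorObj ha hX hY f g).symm])

instance : Neg (EndRing Φ) where
  neg x := Quot.liftOn x (fun p => mk p.1.2 (-p.2))
    (by
      rintro _ _ (⟨⟨a, ha⟩, ⟨X, hX⟩, f⟩ | ⟨⟨a, ha⟩, ⟨X, hX⟩, f⟩)
      · dsimp only
        rw [← mk_objTensor ha hX]
        congr 1
        exact Subtype.ext ((tensorLeft a).map_neg (f := (f : End X)))
      · dsimp only
        rw [← mk_tensorObj ha hX]
        congr 1
        exact Subtype.ext ((tensorRight a).map_neg (f := (f : End X))))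

/-- The zero is the class of the zero endomorphism of any object of `Φ`. -/
noncomputable instance : Zero (EndRing Φ) where
  zero := mk Φ.nonempty.some_mem 0

/-- The unit is the class of the identity of any object of `Φ`. -/
noncomputable instance : One (EndRing Φ) where
  one := mk Φ.nonempty.some_mem 1

lemma mk_add_mk' {X Y : K} (hX : X ∈ Φ.carrier) (hY : Y ∈ Φ.carrier)
    (f : balancedEnd X) (g : balancedEnd Y) :
    mk hX f + mk hY g = mk (Φ.tensor_mem hX hY) (addAux f g) := rfl

lemma mk_mul_mk' {X Y : K} (hX : X ∈ Φ.carrier) (hY : Y ∈ Φ.carrier)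
    (f : balancedEnd X) (g : balancedEnd Y) :
    mk hX f * mk hY g = mk (Φ.tensor_mem hX hY) (mulAux f g) := rfl

lemma objTensor_eq_tensorObj {X : K} (f : balancedEnd X) : objTensor X f = tensorObj f X :=
  Subtype.ext f.2.symm

lemma tensorObj_add {X : K} (f g : balancedEnd X) (Y : K) :
    tensorObj (f + g) Y = tensorObj f Y + tensorObj g Y :=
  Subtype.ext (MonoidalPreadditive.add_whiskerRight (f : End X) (g : End X))

lemma tensorObj_mul {X : K} (f g : balancedEnd X) (Y : K) :
    tensorObj (f * g) Y = tensorObj f Y * tensorObj g Y :=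
  Subtype.ext (comp_whiskerRight (g : End X) (f : End X) Y)

lemma mk_add_mk {X : K} (hX : X ∈ Φ.carrier) (f g : balancedEnd X) :
    mk hX f + mk hX g = mk hX (f + g) := by
  rw [mk_add_mk', addAux, objTensor_eq_tensorObj, ← tensorObj_add, mk_tensorObj hX hX]

lemma mk_mul_mk {X : K} (hX : X ∈ Φ.carrier) (f g : balancedEnd X) :
    mk hX f * mk hX g = mk hX (f * g) := by
  rw [mk_mul_mk', mulAux, objTensor_eq_tensorObj, ← tensorObj_mul, mk_tensorObj hX hX]

lemma neg_mk {X : K} (hX : X ∈ Φ.carrier) (f : balancedEnd X) : -mk hX f = mk hX (-f) := rfl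

lemma mk_zero {X : K} (hX : X ∈ Φ.carrier) : mk hX (0 : balancedEnd X) = (0 : EndRing Φ) := by
  change _ = mk Φ.nonempty.some_mem 0
  rw [← mk_tensorObj Φ.nonempty.some_mem hX, ← mk_objTensor hX Φ.nonempty.some_mem]
  congr 1
  apply Subtype.ext
  change (0 : X ⟶ X) ▷ _ = X ◁ (0 : _ ⟶ _)
  simp

lemma mk_one {X : K} (hX : X ∈ Φ.carrier) : mk hX (1 : balancedEnd X) = (1 : EndRing Φ) := by
  change _ = mk Φ.nonempty.some_mem 1
  rw [← mk_tensorObj Φ.nonempty.some_mem hX, ← mk_objTensor hX Φ.nonempty.some_mem]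
  congr 1
  apply Subtype.ext
  change (𝟙 X : X ⟶ X) ▷ _ = X ◁ (𝟙 _ : _ ⟶ _)
  simp

lemma exists_rep (x : EndRing Φ) :
    ∃ (X : K) (hX : X ∈ Φ.carrier) (f : balancedEnd X), x = mk hX f := by
  obtain ⟨⟨⟨X, hX⟩, f⟩, rfl⟩ := Quot.exists_rep x
  exact ⟨X, hX, f, rfl⟩

/-- Any three elements are represented by endomorphisms of one object. -/
lemma exists_rep₃ (x y z : EndRing Φ) : ∃ (X : K) (hX : X ∈ Φ.carrier) (f g h : balancedEnd X),
    x = mk hX f ∧ y = mk hX g ∧ z = mk hX h := by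
  obtain ⟨X, hX, f, rfl⟩ := exists_rep x
  obtain ⟨Y, hY, g, rfl⟩ := exists_rep y
  obtain ⟨Z, hZ, h, rfl⟩ := exists_rep z
  refine ⟨X ⊗ (Y ⊗ Z), Φ.tensor_mem hX (Φ.tensor_mem hY hZ), tensorObj f (Y ⊗ Z),
    objTensor X (tensorObj g Z), objTensor X (objTensor Y h), ?_, ?_, ?_⟩
  · rw [mk_tensorObj (Φ.tensor_mem hY hZ) hX]
  · rw [mk_objTensor hX (Φ.tensor_mem hY hZ), mk_tensorObj hZ hY]
  · rw [mk_objTensor hX (Φ.tensor_mem hY hZ), mk_objTensor hY hZ]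

/-- `R_Φ` is a commutative ring. -/
noncomputable instance : CommRing (EndRing Φ) where
  add_assoc x y z := by
    obtain ⟨X, hX, f, g, h, rfl, rfl, rfl⟩ := exists_rep₃ x y z
    simp only [mk_add_mk, add_assoc]
  zero_add x := by
    obtain ⟨X, hX, f, rfl⟩ := exists_rep x
    rw [← mk_zero hX, mk_add_mk, zero_add]
  add_zero x := by
    obtain ⟨X, hX, f, rfl⟩ := exists_rep x
    rw [← mk_zero hX, mk_add_mk, add_zero]
  nsmul := nsmulRec
  zsmul := zsmulRec
  neg_add_cancel x := by
    obtain ⟨X, hX, f, rfl⟩ := exists_rep x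
    rw [neg_mk, mk_add_mk, neg_add_cancel, mk_zero]
  add_comm x y := by
    obtain ⟨X, hX, f, g, h, rfl, rfl, -⟩ := exists_rep₃ x y 0
    rw [mk_add_mk, mk_add_mk, add_comm]
  left_distrib x y z := by
    obtain ⟨X, hX, f, g, h, rfl, rfl, rfl⟩ := exists_rep₃ x y z
    simp only [mk_add_mk, mk_mul_mk, mul_add]
  right_distrib x y z := by
    obtain ⟨X, hX, f, g, h, rfl, rfl, rfl⟩ := exists_rep₃ x y z
    simp only [mk_add_mk, mk_mul_mk, add_mul]
  zero_mul x := by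
    obtain ⟨X, hX, f, rfl⟩ := exists_rep x
    rw [← mk_zero hX, mk_mul_mk, zero_mul]
  mul_zero x := by
    obtain ⟨X, hX, f, rfl⟩ := exists_rep x
    rw [← mk_zero hX, mk_mul_mk, mul_zero]
  mul_assoc x y z := by
    obtain ⟨X, hX, f, g, h, rfl, rfl, rfl⟩ := exists_rep₃ x y z
    simp only [mk_mul_mk, mul_assoc]
  one_mul x := by
    obtain ⟨X, hX, f, rfl⟩ := exists_rep x
    rw [← mk_one hX, mk_mul_mk, one_mul]
  mul_one x := by
    obtain ⟨X, hX, f, rfl⟩ := exists_rep x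
    rw [← mk_one hX, mk_mul_mk, mul_one]
  mul_comm x y := by
    obtain ⟨X, hX, f, rfl⟩ := exists_rep x
    obtain ⟨Y, hY, g, rfl⟩ := exists_rep y
    exact mk_mulAux_comm hX hY f g

end EndRing

end Ring

end TensorTriangulatedCategory

/-! Clopen subsets of `Spec R_Φ` correspond to idempotents `e`, so it suffices that a nontrivial `e`
disconnects the zero locus. Represent `e` by a balanced idempotent `f` on some `X ∈ Φ` and put `g =
1 - f`. Idempotents need not split in `K`, so the cones `A` of `f` and `B` of `g` replace the
images: in the idempotent completion, `A` is the image of `g` plus its suspension.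

Three facts make `supp A` and `supp B` a separation. `X` is a retract of `A ⊞ B`, so the two
supports cover the zero locus (`prop_of_cones`). Since `f` is balanced, `A ⊗ f = 0`, hence `A ⊗ B =
0` and no prime lies in both supports (`isZero_tensor_cones`). Finally `g` factors through `A` and
`f` through `B`, with nonzero classes `1 - e` and `e`, so each support meets the zero locus
(`exists_mem_zeroLocus`, by a Zorn argument). -/

namespace TensorTriangulatedCategory

/-! ### Thick tensor ideals and existence of primes. -/

section Ideals

variable {K : Type*} [Category* K] [Preadditive K] [HasZeroObject K]
  [HasShift K ℤ] [∀ n : ℤ, (shiftFunctor K n).Additive] [Pretriangulated K]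
  [MonoidalCategory K]

/-- A thick triangulated `⊗`-ideal. -/
structure IsThickIdeal (J : ObjectProperty K) : Prop where
  isTriangulated : J.IsTriangulated
  thick : J.IsStableUnderRetracts
  tensor_mem (a b : K) : J b → J (a ⊗ b)

lemma isThickIdeal_sSup_of_isChain {c : Set (ObjectProperty K)} (hc : IsChain (· ≤ ·) c)
    (hne : c.Nonempty) (h : ∀ J ∈ c, IsThickIdeal J) :
    IsThickIdeal (K := K) (fun X => ∃ J ∈ c, J X) where
  isTriangulated :=
    { exists_zero := by
        obtain ⟨J, hJ⟩ := hne
        have := (h J hJ).isTriangulated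
        obtain ⟨Z, hZ, hZ'⟩ := J.exists_prop_of_containsZero
        exact ⟨Z, hZ, J, hJ, hZ'⟩
      isStableUnderShiftBy a := ⟨fun X ⟨J, hJ, hX⟩ => ⟨J, hJ, by
        have := (h J hJ).isTriangulated
        exact J.le_shift a X hX⟩⟩
      ext₂' T hT := by
        rintro ⟨J₁, hJ₁, h₁⟩ ⟨J₃, hJ₃, h₃⟩
        obtain ⟨J, hJ, h₁, h₃⟩ : ∃ J ∈ c, J T.obj₁ ∧ J T.obj₃ := by
          rcases hc.total hJ₁ hJ₃ with hle | hle
          exacts [⟨J₃, hJ₃, hle _ h₁, h₃⟩, ⟨J₁, hJ₁, h₁, hle _ h₃⟩]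
        have := (h J hJ).isTriangulated
        have := (h J hJ).thick
        exact ObjectProperty.le_isoClosure _ _
          ⟨J, hJ, J.ext_of_isTriangulatedClosed₂ T hT h₁ h₃⟩ }
  thick := ⟨fun r ⟨J, hJ, hX⟩ => ⟨J, hJ, by
    have := (h J hJ).thick
    exact J.prop_of_retract r hX⟩⟩
  tensor_mem a b := fun ⟨J, hJ, hb⟩ => ⟨J, hJ, (h J hJ).tensor_mem a b hb⟩

lemma isClosed_supp (a : K) : IsClosed (supp a) :=
  ⟨{a}, by simp⟩

variable [SymmetricCategory K] [TensorTriangulatedCategory K]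

lemma isThickIdeal_isZero : IsThickIdeal (K := K) (fun X => IsZero X) where
  isTriangulated :=
    { exists_zero := ⟨0, isZero_zero K, isZero_zero K⟩
      isStableUnderShiftBy a := ⟨fun _ hX => (shiftFunctor K a).map_isZero hX⟩
      ext₂' T hT h₁ h₃ := ObjectProperty.le_isoClosure _ _
        ((Pretriangulated.Triangle.isZero₂_iff T hT).2
          ⟨h₁.eq_of_src _ _, h₃.eq_of_tgt _ _⟩) }
  thick := ⟨fun r h => by
    rw [IsZero.iff_id_eq_zero, ← r.retract, h.eq_of_tgt r.i 0, zero_comp]⟩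
  tensor_mem a _ h := (tensorLeft a).map_isZero h

/-- The ideal quotient `(J : b)`. -/
lemma IsThickIdeal.quotient {J : ObjectProperty K} (hJ : IsThickIdeal J) (b : K) :
    IsThickIdeal (J.inverseImage (tensorLeft b)) where
  isTriangulated := by
    have := hJ.isTriangulated
    have := hJ.thick
    have := exact_tensorLeft b
    infer_instance
  thick := by
    have := hJ.thick
    exact ⟨fun r h => J.prop_of_retract (r.map (tensorLeft b)) h⟩
  tensor_mem a c h := by
    have := hJ.thick
    exact J.prop_of_iso ((α_ a b c).symm ≪≫ whiskerRightIso (β_ a b) c ≪≫ α_ b a c)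
      (hJ.tensor_mem a _ h)

/-- A non-empty collection of non-zero objects closed under the tensor product is avoided by some
prime ideal. -/
lemma exists_spc_disjoint (S : MultiplicativeSet K) (h0 : ∀ s ∈ S.carrier, ¬ IsZero s) :
    ∃ P : Spc K, ∀ s ∈ S.carrier, ¬ P.carrier s := by
  obtain ⟨J, -, ⟨hJ, hJS⟩, hmax⟩ := zorn_le_nonempty₀
    {J : ObjectProperty K | IsThickIdeal J ∧ ∀ s ∈ S.carrier, ¬ J s}
    (fun c hcs hc J hJ => ⟨fun X => ∃ J ∈ c, J X,
      ⟨isThickIdeal_sSup_of_isChain hc ⟨J, hJ⟩ fun J hJ => (hcs hJ).1,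
        fun s hs ⟨J, hJ, hsJ⟩ => (hcs hJ).2 s hs hsJ⟩, fun J hJ X hX => ⟨J, hJ, hX⟩⟩)
    _ ⟨isThickIdeal_isZero, h0⟩
  -- The quotient `(J : b)` contains `J` and also `x ∉ J`, so by maximality it meets `S`.
  have key (b x : K) (hx : J (b ⊗ x)) (hxJ : ¬ J x) : ∃ s ∈ S.carrier, J (b ⊗ s) := by
    by_contra! hc
    exact hxJ (hmax ⟨hJ.quotient b, hc⟩ (fun c => hJ.tensor_mem b c) x hx)
  obtain ⟨s₀, hs₀⟩ := S.nonempty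
  refine ⟨⟨J, hJ.isTriangulated, hJ.thick, hJ.tensor_mem, ⟨s₀, hJS s₀ hs₀⟩, fun a b hab => ?_⟩,
    hJS⟩
  have := hJ.thick
  by_contra! hc
  -- Using `key` twice trades `b` for some `s ∈ S` and then `a` for some `t ∈ S`, which puts `s ⊗ t
  -- ∈ S` into `J`.
  obtain ⟨s, hs, has⟩ := key a b hab hc.2
  obtain ⟨t, ht, hst⟩ := key s a (J.prop_of_iso (β_ a s) has) hc.1
  exact hJS _ (S.tensor_mem hs ht) hst

end Ideals

/-! ### Cones of complementary balanced idempotents. -/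

section Cones

open Pretriangulated

variable {K : Type*} [Category* K] [Preadditive K] [HasZeroObject K]
  [HasShift K ℤ] [∀ n : ℤ, (shiftFunctor K n).Additive] [Pretriangulated K]

/-- If `f + g = 𝟙 X` with `f ≫ g = 0 = g ≫ f`, then `X` belongs to each thick subcategory
containing the cones of `f` and `g`. -/
lemma prop_of_cones (J : ObjectProperty K) [J.IsTriangulated] [J.IsStableUnderRetracts]
    {X A B : K} {f g : X ⟶ X} (hadd : f + g = 𝟙 X) (hfg : f ≫ g = 0) (hgf : g ≫ f = 0)
    {i : X ⟶ A} {p : A ⟶ X⟦(1 : ℤ)⟧} (hA : Triangle.mk f i p ∈ distTriang K)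
    {j : X ⟶ B} {q : B ⟶ X⟦(1 : ℤ)⟧} (hB : Triangle.mk g j q ∈ distTriang K)
    (hJA : J A) (hJB : J B) : J X := by
  -- Each of `f`, `g` kills the other, so each factors through the cone of the other; the sum `g + f
  -- = 𝟙 X` then factors through `A ⊞ B`.
  obtain ⟨r : A ⟶ X, hr : g = i ≫ r⟩ := Triangle.yoneda_exact₂ _ hA g hfg
  obtain ⟨s : B ⟶ X, hs : f = j ≫ s⟩ := Triangle.yoneda_exact₂ _ hB f hgf
  have hAB : J (A ⊞ B) := J.ext_of_isTriangulatedClosed₂ _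
    (binaryBiproductTriangle_distinguished A B) hJA hJB
  refine J.prop_of_retract ⟨biprod.lift i j, biprod.desc r s, ?_⟩ hAB
  rw [biprod.lift_desc, ← hr, ← hs, add_comm, hadd]

variable [MonoidalCategory K] [SymmetricCategory K] [TensorTriangulatedCategory K]

/-- Balancedness lets `f` act on the right-hand factor of the triangle tensored with `X` as it acts
on the left-hand one. Thus `A ⊗ f` vanishes after `i ⊗ X`, hence factors through `p ⊗ X`; and `(A ⊗
f) ≫ (p ⊗ X) = 0` because `p ≫ f⟦1⟧ = 0`. So `A ⊗ f` has square zero, and it is idempotent. -/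
lemma whiskerLeft_cone_eq_zero {X A : K} {f : X ⟶ X} (hf : f ≫ f = f) (hbal : f ▷ X = X ◁ f)
    {i : X ⟶ A} {p : A ⟶ X⟦(1 : ℤ)⟧} (hA : Triangle.mk f i p ∈ distTriang K) :
    A ◁ f = 0 := by
  have := exact_tensorRight X
  have hT := (tensorRight X).map_distinguished _ hA
  have hif : i ▷ X ≫ A ◁ f = 0 := by
    rw [← whisker_exchange, ← hbal, ← comp_whiskerRight, show f ≫ i = 0 from
      comp_distTriang_mor_zero₁₂ _ hA, MonoidalPreadditive.zero_whiskerRight]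
  obtain ⟨h : (X ⊗ X)⟦(1 : ℤ)⟧ ⟶ A ⊗ X, hh⟩ := Triangle.yoneda_exact₃ _ hT (A ◁ f) hif
  change A ◁ f = (p ▷ X ≫ ((tensorRight X).commShiftIso (1 : ℤ)).hom.app X) ≫ h at hh
  have hnat := NatTrans.shift_app_comm ((curriedTensor K).flip.map f) (1 : ℤ) X
  change ((tensorRight X).commShiftIso (1 : ℤ)).hom.app X ≫ (X ◁ f)⟦(1 : ℤ)⟧' =
    X⟦(1 : ℤ)⟧ ◁ f ≫ ((tensorRight X).commShiftIso (1 : ℤ)).hom.app X at hnat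
  have h31 := comp_distTriang_mor_zero₃₁ _ hT
  change (p ▷ X ≫ ((tensorRight X).commShiftIso (1 : ℤ)).hom.app X) ≫ (f ▷ X)⟦(1 : ℤ)⟧' = 0
    at h31
  rw [hbal, Category.assoc, hnat] at h31
  rw [← hf, whiskerLeft_comp]
  nth_rw 2 [hh]
  rw [Category.assoc, whisker_exchange_assoc, reassoc_of% h31, zero_comp]

/-- The tensor product of the cones of two complementary balanced idempotents vanishes. -/
lemma isZero_tensor_cones {X A B : K} {f g : X ⟶ X} (hadd : f + g = 𝟙 X) (hf : f ≫ f = f)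
    (hbal : f ▷ X = X ◁ f)
    {i : X ⟶ A} {p : A ⟶ X⟦(1 : ℤ)⟧} (hA : Triangle.mk f i p ∈ distTriang K)
    {j : X ⟶ B} {q : B ⟶ X⟦(1 : ℤ)⟧} (hB : Triangle.mk g j q ∈ distTriang K) :
    IsZero (A ⊗ B) := by
  have := exact_tensorLeft A
  have hT := (tensorLeft A).map_distinguished _ hB
  -- `A ⊗ B` is the cone of `A ⊗ g`, and `A ⊗ g = 𝟙` because `A ⊗ f = 0`.
  refine (Triangle.isZero₃_iff_isIso₁ _ hT).2 ?_
  change IsIso (A ◁ g)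
  have hg : A ◁ g = 𝟙 _ := by
    rw [← whiskerLeft_id, ← hadd, MonoidalPreadditive.whiskerLeft_add,
      whiskerLeft_cone_eq_zero hf hbal hA, zero_add]
  rw [hg]
  infer_instance

end Cones

namespace EndRing

/-! ### Vanishing and lifting of idempotents in `R_Φ`. -/

section Zero

variable {K : Type*} [Category* K] [Preadditive K] [MonoidalCategory K]

lemma whiskerLeft_whiskerLeft_eq_zero_iff (W a : K) {X : K} (f : X ⟶ X) :
    W ◁ a ◁ f = 0 ↔ (W ⊗ a) ◁ f = 0 := by
  rw [tensor_whiskerLeft]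
  constructor
  · intro h
    rw [h, zero_comp, comp_zero]
  · intro h
    rw [← cancel_epi (α_ W a X).hom, ← cancel_mono (α_ W a X).inv, Category.assoc, h, comp_zero,
      zero_comp]

variable [SymmetricCategory K]

lemma whiskerLeft_whiskerRight_eq_zero_iff (W a : K) {X : K} (f : X ⟶ X) :
    W ◁ f ▷ a = 0 ↔ W ◁ a ◁ f = 0 := by
  rw [← cancel_mono (W ◁ (β_ X a).hom), ← whiskerLeft_comp,
    BraidedCategory.braiding_naturality_left, whiskerLeft_comp, zero_comp,
    ← cancel_epi (W ◁ (β_ X a).hom) (g := W ◁ a ◁ f), comp_zero]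

variable [MonoidalPreadditive K] {Φ : MultiplicativeSet K}

/-- This makes eventual vanishing invariant under the elementary identifications: the braiding moves
`a` to the other side of `X`, and conversely `W` absorbs `a`. -/
lemma exists_whiskerLeft_eq_zero_iff {a X : K} (ha : a ∈ Φ.carrier) (f : X ⟶ X) :
    (∃ W ∈ Φ.carrier, W ◁ f = 0) ↔ ∃ W ∈ Φ.carrier, W ◁ a ◁ f = 0 := by
  constructor
  · rintro ⟨W, hW, h⟩
    refine ⟨W, hW, (whiskerLeft_whiskerRight_eq_zero_iff W a f).1 ?_⟩
    rw [← cancel_epi (α_ W X a).hom, ← associator_naturality_middle, h,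
      MonoidalPreadditive.zero_whiskerRight, zero_comp, comp_zero]
  · rintro ⟨W, hW, h⟩
    exact ⟨W ⊗ a, Φ.tensor_mem hW ha, (whiskerLeft_whiskerLeft_eq_zero_iff W a f).1 h⟩

/-- The class of `f` vanishes iff `W ⊗ f` vanishes for some `W ∈ Φ`. -/
lemma mk_eq_zero_iff {X : K} (hX : X ∈ Φ.carrier) (f : balancedEnd X) :
    mk hX f = 0 ↔ ∃ W ∈ Φ.carrier, W ◁ (f : End X) = 0 := by
  constructor
  -- Eventual vanishing descends to a predicate on the quotient, which holds at the class of zero.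
  · let Q : EndRing Φ → Prop := Quot.lift
      (fun p => ∃ W ∈ Φ.carrier, W ◁ (p.2 : End (p.1 : K)) = 0) (by
        rintro _ _ (⟨⟨a, ha⟩, ⟨Y, hY⟩, g⟩ | ⟨⟨a, ha⟩, ⟨Y, hY⟩, g⟩)
        · exact propext (exists_whiskerLeft_eq_zero_iff ha _)
        · refine propext ((exists_whiskerLeft_eq_zero_iff ha _).trans ?_)
          exact exists_congr fun W => and_congr_right fun _ =>
            (whiskerLeft_whiskerRight_eq_zero_iff W a _).symm)
    intro h
    have h0 : Q (mk hX 0) := ⟨X, hX, MonoidalPreadditive.whiskerLeft_zero⟩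
    rw [mk_zero hX, ← h] at h0
    exact h0
  · rintro ⟨W, hW, h⟩
    rw [← mk_objTensor hW hX, ← mk_zero (Φ.tensor_mem hW hX)]
    exact congrArg _ (Subtype.ext h)

/-- A representative is idempotent only up to a difference killed by some `W ∈ Φ`, so tensoring it
with `W` makes it strictly idempotent. -/
lemma exists_rep_of_isIdempotentElem {e : EndRing Φ} (he : IsIdempotentElem e) :
    ∃ (X : K) (hX : X ∈ Φ.carrier) (f : balancedEnd X), e = mk hX f ∧ IsIdempotentElem f := by
  obtain ⟨X, hX, f, rfl⟩ := exists_rep e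
  have h : mk hX (f * f - f) = 0 := by
    rw [sub_eq_add_neg, ← mk_add_mk, ← mk_mul_mk, ← neg_mk, he.eq, add_neg_cancel]
  obtain ⟨W, hW, h⟩ := (mk_eq_zero_iff hX _).1 h
  refine ⟨W ⊗ X, Φ.tensor_mem hW hX, objTensor W f, (mk_objTensor hW hX f).symm, ?_⟩
  let φ : X ⟶ X := (f : End X)
  have h : (tensorLeft W).map (φ ≫ φ - φ) = 0 := h
  rw [Functor.map_sub, Functor.map_comp, sub_eq_zero] at h
  exact Subtype.ext h

end Zero

/-! ### Nontrivial idempotents disconnect the zero locus. -/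

section Connected

open Pretriangulated

variable {K : Type*} [Category* K] [Preadditive K] [HasZeroObject K]
  [HasShift K ℤ] [∀ n : ℤ, (shiftFunctor K n).Additive] [Pretriangulated K]
  [MonoidalCategory K] [SymmetricCategory K] [TensorTriangulatedCategory K]
  {Φ : MultiplicativeSet K}

/-- The objects through which some `u ∈ E_W`, with `W ∈ Φ` and `[u_W] * e = e`, factors. -/
def factorSet (e : EndRing Φ) : MultiplicativeSet K where
  carrier := {s | ∃ (W : K) (hW : W ∈ Φ.carrier) (u : balancedEnd W) (i : W ⟶ s) (p : s ⟶ W),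
    i ≫ p = (u : End W) ∧ mk hW u * e = e}
  nonempty := ⟨_, _, Φ.nonempty.some_mem, 1, 𝟙 _, 𝟙 _, Category.comp_id _, by
    rw [mk_one, one_mul]⟩
  tensor_mem := by
    rintro s t ⟨W, hW, u, i, p, hu, hue⟩ ⟨V, hV, v, j, q, hv, hve⟩
    refine ⟨W ⊗ V, Φ.tensor_mem hW hV, mulAux u v, i ⊗ₘ j, p ⊗ₘ q, ?_, ?_⟩
    · rw [coe_mulAux, tensorHom_comp_tensorHom, hu, hv, tensorHom_def']
    · rw [← mk_mul_mk' hW hV, mul_assoc, hve, hue]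

/-- `factorSet e` contains `Φ` and `A`, and no zero object: factoring through zero would force `u =
0`, hence `e = 0`. A prime avoiding it is the required point. -/
lemma exists_mem_zeroLocus {e : EndRing Φ} (he : IsIdempotentElem e) (hne : e ≠ 0)
    {W A : K} (hW : W ∈ Φ.carrier) (u : balancedEnd W) (hu : mk hW u = e)
    (i : W ⟶ A) (p : A ⟶ W) (hip : i ≫ p = (u : End W)) :
    (Φ.zeroLocus ∩ supp A).Nonempty := by
  obtain ⟨P, hP⟩ := exists_spc_disjoint (factorSet e) (by
    rintro s ⟨W, hW, u, i, p, hu, hue⟩ hs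
    refine hne ?_
    have : u = 0 := Subtype.ext (hu.symm.trans (by rw [hs.eq_of_tgt i 0, zero_comp]; rfl))
    rw [← hue, this, mk_zero, zero_mul])
  refine ⟨P, Set.mem_iInter₂.2 fun Y hY => hP Y ⟨Y, hY, 1, 𝟙 _, 𝟙 _, Category.comp_id _, ?_⟩,
    hP A ⟨W, hW, u, i, p, hip, ?_⟩⟩
  · rw [mk_one, one_mul]
  · rw [hu, he.eq]

lemma eq_zero_or_eq_one_of_isPreconnected (hΦ : IsPreconnected Φ.zeroLocus) {e : EndRing Φ}
    (he : IsIdempotentElem e) : e = 0 ∨ e = 1 := by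
  by_contra! hne
  obtain ⟨X, hX, F, hF, hFF⟩ := exists_rep_of_isIdempotentElem he
  let f : X ⟶ X := (F : End X)
  let g : X ⟶ X := ((1 - F : balancedEnd X) : End X)
  have hadd : f + g = 𝟙 X := congrArg Subtype.val (add_sub_cancel F 1)
  have hff : f ≫ f = f := congrArg Subtype.val hFF.eq
  have hfg : f ≫ g = 0 := congrArg Subtype.val hFF.one_sub_mul_self
  have hgf : g ≫ f = 0 := congrArg Subtype.val hFF.mul_one_sub_self
  have hG : mk hX (1 - F) = 1 - e := by
    rw [sub_eq_add_neg, ← mk_add_mk, mk_one, ← neg_mk, ← hF, sub_eq_add_neg]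
  obtain ⟨A, i, p, hA⟩ := distinguished_cocone_triangle f
  obtain ⟨B, j, q, hB⟩ := distinguished_cocone_triangle g
  obtain ⟨r : A ⟶ X, hr : g = i ≫ r⟩ := Triangle.yoneda_exact₂ _ hA g hfg
  obtain ⟨s : B ⟶ X, hs : f = j ≫ s⟩ := Triangle.yoneda_exact₂ _ hB f hgf
  obtain ⟨P, hP, hPA, hPB⟩ := isPreconnected_closed_iff.1 hΦ (supp A) (supp B)
    (isClosed_supp A) (isClosed_supp B)
    (fun P hP => by
      have := P.isTriangulated
      have := P.thick
      by_contra hc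
      simp only [supp, Set.mem_union, Set.mem_ofPred_eq, not_or, not_not] at hc
      exact Set.mem_iInter₂.1 hP X hX (prop_of_cones P.carrier hadd hfg hgf hA hB hc.1 hc.2))
    -- The roles cross: the cone `A` of `f` carries `g`, of class `1 - e`, while `B` carries `f`, of
    -- class `e`.
    (exists_mem_zeroLocus he.one_sub (sub_ne_zero.2 hne.2.symm) hX _ hG i r hr.symm)
    (exists_mem_zeroLocus he hne.1 hX _ hF.symm j s hs.symm)
  have := P.isTriangulated
  have := P.thick
  rcases P.prime A B (P.carrier.prop_of_isZero (isZero_tensor_cones hadd hff F.2 hA hB)) with h | h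
  exacts [hPA h, hPB h]

/-- If `1 = 0`, some `W ⊗ X ∈ Φ` is a zero object and so lies in every prime. -/
lemma nontrivial_of_nonempty (hΦ : Φ.zeroLocus.Nonempty) : Nontrivial (EndRing Φ) := by
  refine ⟨⟨1, 0, fun h => ?_⟩⟩
  obtain ⟨P, hP⟩ := hΦ
  have := P.isTriangulated
  have := P.thick
  obtain ⟨X, hX⟩ := Φ.nonempty
  rw [← mk_one hX, mk_eq_zero_iff] at h
  obtain ⟨W, hW, h⟩ := h
  refine Set.mem_iInter₂.1 hP _ (Φ.tensor_mem hW hX) (P.carrier.prop_of_isZero ?_)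
  rw [IsZero.iff_id_eq_zero, ← whiskerLeft_id]
  exact h

end Connected

end EndRing

end TensorTriangulatedCategory

/-! ### From idempotents to connectedness of the spectrum. -/

theorem mainTheorem7 {K : Type*} [Category* K] [Preadditive K] [HasZeroObject K]
    [HasShift K ℤ] [∀ n : ℤ, (shiftFunctor K n).Additive] [Pretriangulated K]
    [IsTriangulated K] [MonoidalCategory K] [SymmetricCategory K]
    [TensorTriangulatedCategory K]
    (Φ : TensorTriangulatedCategory.MultiplicativeSet K) :
    (_root_.IsPreconnected Φ.zeroLocus →
      PreconnectedSpace (PrimeSpectrum (TensorTriangulatedCategory.EndRing Φ))) ∧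
    (_root_.IsConnected Φ.zeroLocus →
      ConnectedSpace (PrimeSpectrum (TensorTriangulatedCategory.EndRing Φ))) := by
  have hpre (h : _root_.IsPreconnected Φ.zeroLocus) :
      PreconnectedSpace (PrimeSpectrum (TensorTriangulatedCategory.EndRing Φ)) := by
    refine preconnectedSpace_iff_clopen.2 fun s hs => ?_
    obtain ⟨e, he, rfl⟩ := PrimeSpectrum.isClopen_iff.1 hs
    rcases TensorTriangulatedCategory.EndRing.eq_zero_or_eq_one_of_isPreconnected h he with
      rfl | rfl
    · exact Or.inl (by simp)
    · exact Or.inr (by simp)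
  refine ⟨hpre, fun h => ?_⟩
  have := hpre h.isPreconnected
  have := TensorTriangulatedCategory.EndRing.nontrivial_of_nonempty h.nonempty
  exact { toNonempty := inferInstance }
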